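/- Let $\mathbf k$ be a field. For a set $Y$ let $\mathfrak M(Y)$ be the free monoid with an operator $w\mapsto\lfloor w\rfloor$ on $Y$ (its elements are the bracketed words on $Y$; the breadth $|w|$ is the number of factors of $w$ from $Y\cup\lfloor\mathfrak M(Y)\rfloor$), and let $\mathbf k\mathfrak M(Y)$ be the free operated $\mathbf k$-algebra on $Y$, with basis $\mathfrak M(Y)$. A $\star$-bracketed word on $Y$ is a bracketed word $q$ on $Y\cup\{\star\}$ with exactly one occurrence of $\star$; $q|_u$ is $q$ with $\star$ replaced by $u\in\mathfrak M(Y)$, extended linearly to $q|_s$ for $s\in\mathbf k\mathfrak M(Y)$. $\mathrm{Id}(S)$ is the operated ideal (two-sided ideal closed under the operator) generated by $S$. A system of operated polynomial identities (OPIs) is a subset $\Phi\subseteq\mathbf k\mathfrak M(X)$, $X$ a set. For a set $Z$ let $S_\Phi(Z)\subseteq\mathbf k\mathfrak M(Z)$ be the set of all $\phi(u_1,\dots,u_k)$ with $\phi(x_1,\dots,x_k)\in\Phi$ and $u_1,\dots,u_k\in\mathfrak M(Z)$. Rewriting. A term-rewriting system on $\mathbf k\mathfrak M(Z)$ is a set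 of rules $t\to v$ with $t\in\mathfrak M(Z)$, $v\in\mathbf k\mathfrak M(Z)$. It rewrites in one step any $f$ in which $t$ has coefficient $c\neq0$ to $f-ct+cv$. It is convergent if there is no infinite chain of one-step rewritings and, whenever $f$ rewrites in finitely many (possibly zero) steps to $g$ and to $h$, both $g$ and $h$ rewrite in finitely many steps to a common element. An orientation of $S\subseteq\mathbf k\mathfrak M(Z)$ chooses for every nonzero $s\in S$ a monomial $\tilde s$ of $s$; with $c$ its coefficient in $s$, put $R(s)=\tilde s-c^{-1}s$. The associated system consists of all rules $q|_{\tilde s}\to q|_{R(s)}$ ($0\ne s\in S$, $q$ a $\star$-bracketed word on $Z$). $\Phi$ is convergent on $Z$ with respect to an orientation of $S_\Phi(Z)$ if the system associated to $S_\Phi(Z)$ and that orientation is convergent. It is potentially convergent on $Z$ with respect to that orientation if there are $\Phi'$ with $\Phi\subseteq\Phi'\subseteq\mathbf k\mathfrak M(X)$ and $\mathrm{Id}(S_{\Phi'}(Z))=\mathrm{Id}(S_\Phi(Z))$ and an orientation of $S_{\Phi'}(Z)$ extending the given one with respect to which $\Phi'$ is convergent on $Z$. $\Phi$ is convergent (resp.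 potentially convergent) if for each set $Z$ there is an orientation of $S_\Phi(Z)$ with respect to which it is so on $Z$. Gröbner–Shirshov. A monomial order on $\mathfrak M(Z)$ is a well-order $\le$ such that $u<v$ implies $q|_u<q|_v$ for all $\star$-bracketed words $q$ on $Z$. Let $\bar f$ be the leading (largest) monomial of $f\neq0$, and $\bar 0=1$. An element $h$ is trivial modulo $(S,w)$ if $h=\sum_i c_i\,q_i|_{s_i}$ (a finite, possibly empty sum) with $c_i\in\mathbf k$, $s_i\in S$ and $q_i|_{\bar s_i}<w$. $S\subseteq\mathbf k\mathfrak M(Z)$ is a Gröbner–Shirshov basis with respect to $\le$ if for all $f,g$ that are nonzero elements of $S$ divided by their leading coefficients: $fu-vg$ is trivial modulo $(S,w)$ whenever $w=\bar fu=v\bar g$ with $u,v\in\mathfrak M(Z)$ and $\max\{|\bar f|,|\bar g|\}<|w|<|\bar f|+|\bar g|$; and $f-q|_g$ is trivial modulo $(S,w)$ whenever $w=\bar f=q|_{\bar g}$ with $q$ a $\star$-bracketed word. $\Phi$ is Gröbner–Shirshov on $Z$ with respect to $\le$ if $S_\Phi(Z)$ is a Gröbner–Shirshov basis with respect to $\le$;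 it is potentially Gröbner–Shirshov on $Z$ with respect to $\le$ if some $\Phi'$ with $\Phi\subseteq\Phi'\subseteq\mathbf k\mathfrak M(X)$ and $\mathrm{Id}(S_{\Phi'}(Z))=\mathrm{Id}(S_\Phi(Z))$ is Gröbner–Shirshov on $Z$ with respect to $\le$. $\Phi$ is Gröbner–Shirshov (resp. potentially Gröbner–Shirshov) if for each set $Z$ there is a monomial order on $\mathfrak M(Z)$ with respect to which it is so on $Z$. Theorem. Let $\Phi\subseteq\mathbf k\mathfrak M(X)$ be a system of OPIs. (a) For any set $Z$ and any monomial order $\le$ on $\mathfrak M(Z)$, $\Phi$ is Gröbner–Shirshov on $Z$ with respect to $\le$ if and only if $\Phi$ is convergent on $Z$ with respect to the orientation $s\mapsto\bar s$ of $S_\Phi(Z)$ by leading monomials. (b) If $\Phi$ is Gröbner–Shirshov, then $\Phi$ is convergent. (c) If $\Phi$ is potentially Gröbner–Shirshov, then $\Phi$ is potentially convergent. -/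

import Mathlib

universe u v w

namespace RotaOPI

/-! ## Bracketed words: the free operated monoid -/

/-- Bracketed words on `X`, the elements of `𝔐(X)`. A bracketed word is a finite (possibly empty)
product of letters, a letter being a variable `x` or a bracket `⌊u⌋` of a bracketed word `u`.
So every word is exactly one of: the empty word `1`, `x * t` (`cons x t`),
`⌊u⌋ * t` (`consBr u t`). -/
inductive Word (X : Type u) : Type u
  | nil : Word X
  | cons (x : X) (t : Word X) : Word X
  | consBr (u : Word X) (t : Word X) : Word X

namespace Word

variable {X : Type u}

/-- Concatenation of bracketed words. -/
def append : Word X → Word X → Word X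
  | nil, b => b
  | cons x t, b => cons x (append t b)
  | consBr a t, b => consBr a (append t b)

instance : One (Word X) := ⟨nil⟩

instance : Mul (Word X) := ⟨append⟩

theorem nil_eq_one : (nil : Word X) = 1 := rfl

theorem one_mul' (b : Word X) : 1 * b = b := rfl

theorem cons_mul (x : X) (t b : Word X) : cons x t * b = cons x (t * b) := rfl

theorem consBr_mul (a t b : Word X) : consBr a t * b = consBr a (t * b) := rfl

theorem mul_one' (a : Word X) : a * 1 = a := by
  induction a with
  | nil => rfl
  | cons x t ih => rw [cons_mul, ih]
  | consBr a t _ ih => rw [consBr_mul, ih]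

theorem mul_assoc' (a b c : Word X) : a * b * c = a * (b * c) := by
  induction a with
  | nil => rfl
  | cons x t ih => simp only [cons_mul, ih]
  | consBr a t _ ih => simp only [consBr_mul, ih]

instance : Monoid (Word X) where
  mul_assoc := mul_assoc'
  one_mul := one_mul'
  mul_one := mul_one'

/-- The variable `x` as a bracketed word. -/
def var (x : X) : Word X := cons x 1

/-- The operator `w ↦ ⌊w⌋` on bracketed words. -/
def br (a : Word X) : Word X := consBr a 1

theorem cons_eq (x : X) (t : Word X) : cons x t = var x * t := rfl

theorem consBr_eq (a t : Word X) : consBr a t = br a * t := rfl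

/-- The breadth: the number of letters (variables or brackets) of the outermost product. -/
def breadth : Word X → ℕ
  | nil => 0
  | cons _ t => breadth t + 1
  | consBr _ t => breadth t + 1

section Lift

variable {U : Type v} [Monoid U]

/-- Evaluation of a bracketed word in a monoid `U` with a map `P : U → U`, at `θ : X → U`. -/
def evalFun (P : U → U) (θ : X → U) : Word X → U
  | nil => 1
  | cons x t => θ x * evalFun P θ t
  | consBr a t => P (evalFun P θ a) * evalFun P θ t

theorem evalFun_mul (P : U → U) (θ : X → U) (a b : Word X) :
    evalFun P θ (a * b) = evalFun P θ a * evalFun P θ b := by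
  induction a with
  | nil => rw [nil_eq_one, one_mul]; exact (one_mul _).symm
  | cons x t ih => rw [cons_mul]; simp only [evalFun, ih, mul_assoc]
  | consBr a t _ ih => rw [consBr_mul]; simp only [evalFun, ih, mul_assoc]

/-- The morphism of operated monoids `𝔐(X) → (U, P)` extending `θ : X → U`. -/
def lift (P : U → U) (θ : X → U) : Word X →* U where
  toFun := evalFun P θ
  map_one' := rfl
  map_mul' := evalFun_mul P θ

theorem lift_var (P : U → U) (θ : X → U) (x : X) : lift P θ (var x) = θ x :=
  mul_one (θ x)

theorem lift_br (P : U → U) (θ : X → U) (a : Word X) : lift P θ (br a) = P (lift P θ a) :=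
  mul_one _

/-- `𝔐(X)` is the free operated monoid on `X`: uniqueness of the extension. -/
theorem lift_unique (P : U → U) (θ : X → U) (f : Word X →* U)
    (hv : ∀ x, f (var x) = θ x) (hb : ∀ a, f (br a) = P (f a)) : f = lift P θ := by
  ext a
  induction a with
  | nil => rw [nil_eq_one, map_one, map_one]
  | cons x t ih => rw [cons_eq, map_mul, map_mul, hv, lift_var, ih]
  | consBr a t iha ih => rw [consBr_eq, map_mul, map_mul, hb, lift_br, iha, ih]

end Lift

end Word

/-! ## Operated polynomials, evaluations and operated ideals -/

/-- `𝐤𝔐(X)`: the `𝐤`-algebra with basis the monoid of bracketed words. -/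
abbrev Poly (k : Type u) [Field k] (X : Type v) : Type (max u v) := MonoidAlgebra k (Word X)

section Poly

variable {k : Type u} [Field k] {X : Type v} {Z : Type w}

/-- A bracketed word as a monomial of `𝐤𝔐(X)`. -/
noncomputable def mono (k : Type u) [Field k] (a : Word X) : Poly k X := MonoidAlgebra.single a 1

/-- The linear extension of `⌊ ⌋` to an operator on `𝐤𝔐(X)`. -/
noncomputable def polyBr : Poly k X →ₗ[k] Poly k X :=
  MonoidAlgebra.mapDomainLinearMap k k Word.br

/-- The evaluation `φ ↦ φ(r)` of operated polynomials in an operated algebra `(R, P)` at a point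
`r : X → R`: the morphism of operated algebras with `x ↦ r x`. -/
noncomputable def evalPoly {R : Type w} [Ring R] [Algebra k R] (P : R →ₗ[k] R) (r : X → R) :
    Poly k X →ₐ[k] R :=
  MonoidAlgebra.lift k R (Word X) (Word.lift P r)

theorem evalPoly_mono {R : Type w} [Ring R] [Algebra k R] (P : R →ₗ[k] R) (r : X → R)
    (a : Word X) : evalPoly P r (mono k a) = Word.lift P r a := by
  simp [evalPoly, mono]

theorem evalPoly_var {R : Type w} [Ring R] [Algebra k R] (P : R →ₗ[k] R) (r : X → R) (x : X) :
    evalPoly P r (mono k (Word.var x)) = r x := by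
  rw [evalPoly_mono, Word.lift_var]

theorem evalPoly_br {R : Type w} [Ring R] [Algebra k R] (P : R →ₗ[k] R) (r : X → R)
    (f : Poly k X) : evalPoly P r (polyBr f) = P (evalPoly P r f) := by
  induction f using MonoidAlgebra.induction_linear with
  | zero => simp
  | add f g hf hg => simp [hf, hg]
  | single a c => simp [polyBr, evalPoly, Word.lift_br]

/-- `S_Φ(Z)`: all `φ(u₁, …, u_k)` with `φ ∈ Φ` and bracketed words `u_i` on `Z`. -/
def substSet (Φ : Set (Poly k X)) (Z : Type w) : Set (Poly k Z) :=
  {s | ∃ φ ∈ Φ, ∃ θ : X → Word Z, s = evalPoly polyBr (fun x => mono k (θ x)) φ}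

/-- A two-sided ideal of `𝐤𝔐(Z)` closed under the operator. -/
structure IsOperatedIdeal (I : Submodule k (Poly k Z)) : Prop where
  mul_left : ∀ a f : Poly k Z, f ∈ I → a * f ∈ I
  mul_right : ∀ f a : Poly k Z, f ∈ I → f * a ∈ I
  br_mem : ∀ f : Poly k Z, f ∈ I → polyBr f ∈ I

/-- `Id(S)`: the smallest operated ideal containing `S`. -/
noncomputable def operatedIdeal (S : Set (Poly k Z)) : Submodule k (Poly k Z) :=
  sInf {I | IsOperatedIdeal I ∧ S ⊆ I}

/-! ## Words with one hole -/

/-- The number of occurrences of the symbol `⋆ = none` in a word on `Z ∪ {⋆} = Option Z`. -/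
def starCount : Word (Option Z) → ℕ
  | .nil => 0
  | .cons none t => starCount t + 1
  | .cons (some _) t => starCount t
  | .consBr a t => starCount a + starCount t

/-- `⋆`-bracketed words on `Z`: exactly one occurrence of `⋆`. -/
def StarWord (Z : Type w) : Type w := {q : Word (Option Z) // starCount q = 1}

/-- `q|_a`: replace `⋆` in `q` by the bracketed word `a`. -/
def StarWord.plug (q : StarWord Z) (a : Word Z) : Word Z :=
  Word.lift Word.br (fun o : Option Z => o.elim a Word.var) q.1

/-- `q|_s` for `s ∈ 𝐤𝔐(Z)`, by linear extension. -/
noncomputable def StarWord.plugPoly (q : StarWord Z) : Poly k Z →ₗ[k] Poly k Z :=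
  MonoidAlgebra.mapDomainLinearMap k k q.plug

end Poly

/-! ## Term-rewriting systems -/

section Rewriting

variable {k : Type u} [Field k] {W : Type w}

/-- One-step rewriting on the space `𝐤W` with basis `W`, for a set `Π` of rules `t → v` with
`t ∈ W` and `v ∈ 𝐤W`: if `t ∈ Supp f` has coefficient `c`, so that `f = c t - R_t(f)` with
`R_t(f) = c t - f`, then `f` rewrites to `c v - R_t(f)`. -/
def OneStep (Rules : Set (W × MonoidAlgebra k W)) (f g : MonoidAlgebra k W) : Prop :=
  ∃ t v, (t, v) ∈ Rules ∧ t ∈ f.coeff.support ∧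
    g = f.coeff t • v - (MonoidAlgebra.single t (f.coeff t) - f)

/-- `f` rewrites to `g`: the reflexive-transitive closure of one-step rewriting. -/
def Rewrites (Rules : Set (W × MonoidAlgebra k W)) :
    MonoidAlgebra k W → MonoidAlgebra k W → Prop :=
  Relation.ReflTransGen (OneStep Rules)

def Joinable (Rules : Set (W × MonoidAlgebra k W)) (f g : MonoidAlgebra k W) : Prop :=
  ∃ h, Rewrites Rules f h ∧ Rewrites Rules g h

def Terminating (Rules : Set (W × MonoidAlgebra k W)) : Prop :=
  ¬ ∃ f : ℕ → MonoidAlgebra k W, ∀ n, OneStep Rules (f n) (f (n + 1))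

def Confluent (Rules : Set (W × MonoidAlgebra k W)) : Prop :=
  ∀ f g h, Rewrites Rules f g → Rewrites Rules f h → Joinable Rules g h

def Convergent (Rules : Set (W × MonoidAlgebra k W)) : Prop :=
  Terminating Rules ∧ Confluent Rules

end Rewriting

/-! ## Orientations and convergent systems of OPIs -/

section Orient

variable {k : Type u} [Field k] {X : Type v} {Z : Type w}

/-- An orientation of `S`: a chosen monomial `fix s` of each `s ∈ S`. The element `0` has no
monomial and is left out; values of `fix` at `0` and outside `S` are irrelevant. -/
structure Orient (S : Set (Poly k Z)) where
  fix : Poly k Z → Word Z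
  fix_mem : ∀ s ∈ S, s ≠ 0 → fix s ∈ s.coeff.support

/-- `R(s)` for the monicization of `s` at its monomial `a`: if `c` is the coefficient of `a` in
`s`, then `c⁻¹ s = a - R(s)`. -/
noncomputable def remainder (a : Word Z) (s : Poly k Z) : Poly k Z :=
  mono k a - (s.coeff a)⁻¹ • s

/-- The term-rewriting system of `S` with respect to an orientation: all rules
`q|_{fix s} → q|_{R(s)}`, for nonzero `s ∈ S` and `⋆`-bracketed words `q`. -/
def rules (S : Set (Poly k Z)) (σ : Orient S) : Set (Word Z × Poly k Z) :=
  {p | ∃ s ∈ S, s ≠ 0 ∧ ∃ q : StarWord Z,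
    p = (q.plug (σ.fix s), q.plugPoly (remainder (σ.fix s) s))}

/-- `Φ` is convergent on `Z` with respect to an orientation of `S_Φ(Z)`. -/
def ConvergentOn (Φ : Set (Poly k X)) (Z : Type w) (σ : Orient (substSet Φ Z)) : Prop :=
  Convergent (rules (substSet Φ Z) σ)

/-- `Φ` is potentially convergent on `Z` with respect to an orientation of `S_Φ(Z)`: some
`Φ' ⊇ Φ` with the same operated ideal on `Z` is convergent on `Z` with respect to an orientation
extending the given one. -/
def PotentiallyConvergentOn (Φ : Set (Poly k X)) (Z : Type w)
    (σ : Orient (substSet Φ Z)) : Prop :=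
  ∃ Φ' : Set (Poly k X), Φ ⊆ Φ' ∧
    operatedIdeal (substSet Φ Z) = operatedIdeal (substSet Φ' Z) ∧
    ∃ σ' : Orient (substSet Φ' Z),
      (∀ s ∈ substSet Φ Z, s ≠ 0 → σ'.fix s = σ.fix s) ∧ ConvergentOn Φ' Z σ'

/-- `Φ` is convergent: for each set `Z` (in the universe `w`), with respect to some orientation. -/
def IsConvergent (Φ : Set (Poly k X)) : Prop :=
  ∀ Z : Type w, ∃ σ : Orient (substSet Φ Z), ConvergentOn Φ Z σ

/-- `Φ` is potentially convergent. -/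
def IsPotentiallyConvergent (Φ : Set (Poly k X)) : Prop :=
  ∀ Z : Type w, ∃ σ : Orient (substSet Φ Z), PotentiallyConvergentOn Φ Z σ

end Orient

/-! ## Monomial orders and Gröbner–Shirshov bases -/

section GS

variable {k : Type u} [Field k] {X : Type v} {Z : Type w}

/-- A monomial order on `𝔐(Z)`: a well-order with `a < b → q|_a < q|_b`. -/
structure IsMonomialOrder (ord : LinearOrder (Word Z)) : Prop where
  wf : WellFounded ord.lt
  plug_lt : ∀ (a b : Word Z) (q : StarWord Z), ord.lt a b → ord.lt (q.plug a) (q.plug b)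

open Classical in
/-- The leading monomial: the largest monomial of `f`, and `1` by convention when `f = 0`. -/
noncomputable def lm (ord : LinearOrder (Word Z)) (f : Poly k Z) : Word Z :=
  if h : f.coeff.support.Nonempty then @Finset.max' (Word Z) ord f.coeff.support h else 1

theorem lm_mem (ord : LinearOrder (Word Z)) (f : Poly k Z) (hf : f ≠ 0) :
    lm ord f ∈ f.coeff.support := by
  have h : f.coeff.support.Nonempty :=
    Finsupp.support_nonempty_iff.mpr fun h0 => hf (MonoidAlgebra.coeff_eq_zero.mp h0)
  rw [lm, dif_pos h]
  exact @Finset.max'_mem (Word Z) ord _ h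

/-- The orientation of `S` from a linear order: `s` is oriented by its leading monomial. -/
noncomputable def lmOrient (ord : LinearOrder (Word Z)) (S : Set (Poly k Z)) : Orient S where
  fix := lm ord
  fix_mem := fun s _ hs => lm_mem ord s hs

/-- The monicization of `f`: its quotient by the coefficient of the leading monomial. -/
noncomputable def monic (ord : LinearOrder (Word Z)) (f : Poly k Z) : Poly k Z :=
  (f.coeff (lm ord f))⁻¹ • f

/-- `h` is trivial modulo `(S, w)`: it is a linear combination of elements `q|_s` with `s ∈ S` and
`q|_{lm s} < w`. -/
def TrivialMod (ord : LinearOrder (Word Z)) (S : Set (Poly k Z)) (w : Word Z)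
    (h : Poly k Z) : Prop :=
  h ∈ Submodule.span k
    {p | ∃ s ∈ S, ∃ q : StarWord Z, ord.lt (q.plug (lm ord s)) w ∧ p = q.plugPoly s}

/-- All intersection compositions `f u - v g` of the monic elements `f, g` are trivial. -/
def IntersectionTrivial (ord : LinearOrder (Word Z)) (S : Set (Poly k Z)) (f g : Poly k Z) :
    Prop :=
  ∀ w a b : Word Z, w = lm ord f * a → w = b * lm ord g →
    max (lm ord f).breadth (lm ord g).breadth < w.breadth →
    w.breadth < (lm ord f).breadth + (lm ord g).breadth →
    TrivialMod ord S w (f * mono k a - mono k b * g)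

/-- All including compositions `f - q|_g` of the monic elements `f, g` are trivial. -/
def IncludingTrivial (ord : LinearOrder (Word Z)) (S : Set (Poly k Z)) (f g : Poly k Z) : Prop :=
  ∀ (w : Word Z) (q : StarWord Z), w = lm ord f → w = q.plug (lm ord g) →
    TrivialMod ord S w (f - q.plugPoly g)

/-- `S` is a Gröbner–Shirshov basis: all compositions of (monicized) elements of `S` are trivial.
The element `0` cannot be made monic and has no compositions. -/
def IsGSBasis (ord : LinearOrder (Word Z)) (S : Set (Poly k Z)) : Prop :=
  ∀ f ∈ S, ∀ g ∈ S, f ≠ 0 → g ≠ 0 →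
    IntersectionTrivial ord S (monic ord f) (monic ord g) ∧
    IncludingTrivial ord S (monic ord f) (monic ord g)

/-- `Φ` is Gröbner–Shirshov on `Z` with respect to the order. -/
def GSOn (Φ : Set (Poly k X)) (Z : Type w) (ord : LinearOrder (Word Z)) : Prop :=
  IsGSBasis ord (substSet Φ Z)

/-- `Φ` is potentially Gröbner–Shirshov on `Z` with respect to the order. -/
def PotentiallyGSOn (Φ : Set (Poly k X)) (Z : Type w) (ord : LinearOrder (Word Z)) : Prop :=
  ∃ Φ' : Set (Poly k X), Φ ⊆ Φ' ∧
    operatedIdeal (substSet Φ Z) = operatedIdeal (substSet Φ' Z) ∧ GSOn Φ' Z ord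

/-- `Φ` is Gröbner–Shirshov: for each set `Z` (in the universe `w`), with respect to some
monomial order. -/
def IsGS (Φ : Set (Poly k X)) : Prop :=
  ∀ Z : Type w, ∃ ord : LinearOrder (Word Z), IsMonomialOrder ord ∧ GSOn Φ Z ord

/-- `Φ` is potentially Gröbner–Shirshov. -/
def IsPotentiallyGS (Φ : Set (Poly k X)) : Prop :=
  ∀ Z : Type w, ∃ ord : LinearOrder (Word Z), IsMonomialOrder ord ∧ PotentiallyGSOn Φ Z ord

end GS

end RotaOPI

/-! The equivalence in (a) holds for every set `S` of operated polynomials, not only for `S_Φ(Z)`;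
(b) and (c) follow by orienting by leading monomials.

Termination needs only the monomial order: a step at `t` removes `t` and adds only smaller
monomials. So the content is Gröbner–Shirshov ⇔ confluent.

From Gröbner–Shirshov to confluent, the key fact is that `q₁|_f` and `q₂|_g` (`f`, `g` monic) with
the same leading monomial `w` are congruent modulo terms below `w` (`IsGSBasis.trivialMod_sub`). By
`placement`, the two occurrences in `w` are nested (an including composition), overlapping (an
intersection composition) or separated (always trivial). The composition-diamond lemma
`IsGSBasis.exists_lm_eq` follows: every nonzero combination of elements `q|_s` has a reducible
leading monomial. Two normal forms of one element differ by such a combination, so they are equal.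

Conversely, a composition at `w` compares two one-step rewritings of `w`. Joining them uses only
monomials below `w`, which exhibits the composition as trivial (`Confluent.trivialMod_sub`). -/

namespace RotaOPI

/-! ### Contexts in bracketed words and the relative position of two subwords. -/

section Contexts

variable {Z : Type w}

theorem Word.breadth_mul (a b : Word Z) : (a * b).breadth = a.breadth + b.breadth := by
  induction a with
  | nil => exact (Nat.zero_add _).symm
  | cons x t ih => rw [Word.cons_mul]; simp only [Word.breadth, ih]; omega
  | consBr a t _ ih => rw [Word.consBr_mul]; simp only [Word.breadth, ih]; omega

theorem Word.breadth_eq_zero {a : Word Z} : a.breadth = 0 ↔ a = 1 := by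
  cases a with
  | nil => exact ⟨fun _ => rfl, fun _ => rfl⟩
  | cons x t => exact ⟨fun h => absurd h (Nat.succ_ne_zero _), fun h => nomatch h⟩
  | consBr a t => exact ⟨fun h => absurd h (Nat.succ_ne_zero _), fun h => nomatch h⟩

/-- Levi's lemma: two factorizations of a bracketed word have a common refinement. -/
theorem Word.levi {a b c d : Word Z} (h : a * b = c * d) :
    (∃ e, c = a * e ∧ b = e * d) ∨ (∃ e, a = c * e ∧ d = e * b) := by
  induction a generalizing c with
  | nil => exact Or.inl ⟨c, rfl, h⟩
  | cons x t ih =>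
    cases c with
    | nil => exact Or.inr ⟨_, rfl, h.symm⟩
    | cons y s =>
      obtain ⟨rfl, ht⟩ := Word.cons.inj h
      rcases ih ht with ⟨e, rfl, h2⟩ | ⟨e, rfl, h2⟩
      · exact Or.inl ⟨e, rfl, h2⟩
      · exact Or.inr ⟨e, rfl, h2⟩
    | consBr y s => exact nomatch h
  | consBr x t _ ih =>
    cases c with
    | nil => exact Or.inr ⟨_, rfl, h.symm⟩
    | cons y s => exact nomatch h
    | consBr y s =>
      obtain ⟨rfl, ht⟩ := Word.consBr.inj h
      rcases ih ht with ⟨e, rfl, h2⟩ | ⟨e, rfl, h2⟩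
      · exact Or.inl ⟨e, rfl, h2⟩
      · exact Or.inr ⟨e, rfl, h2⟩

/-- A bracket occurring in a product of two words lies in one of the factors. -/
theorem Word.levi_br {a b c d x : Word Z} (h : a * b = c * (Word.br x * d)) :
    (∃ e, a = c * (Word.br x * e) ∧ d = e * b) ∨ (∃ e, c = a * e ∧ b = e * (Word.br x * d)) := by
  rcases Word.levi h with h | ⟨e, rfl, h2⟩
  · exact Or.inr h
  -- A bracket is a single letter, so the cut cannot fall inside it: either `e` is empty or it
  -- starts with the whole bracket.
  · cases e with
    | nil => exact Or.inr ⟨1, by simp [Word.nil_eq_one], h2.symm⟩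
    | cons y s => exact nomatch h2
    | consBr y s =>
      obtain ⟨rfl, rfl⟩ := Word.consBr.inj h2
      exact Or.inl ⟨s, rfl, rfl⟩

/-- The functions `x ↦ q|_x` for `⋆`-bracketed words `q`. -/
inductive IsCtx : (Word Z → Word Z) → Prop
  | base (a b : Word Z) : IsCtx fun x => a * (x * b)
  | br (a b : Word Z) {c : Word Z → Word Z} (hc : IsCtx c) :
      IsCtx fun x => a * (Word.br (c x) * b)

theorem IsCtx.id : IsCtx fun x : Word Z => x := by
  simpa using IsCtx.base (1 : Word Z) 1

theorem IsCtx.mul {c : Word Z → Word Z} (hc : IsCtx c) (a b : Word Z) :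
    IsCtx fun x => a * (c x * b) := by
  cases hc with
  | base a' b' => simpa only [mul_assoc] using IsCtx.base (a * a') (b' * b)
  | br a' b' hc => simpa only [mul_assoc] using IsCtx.br (a * a') (b' * b) hc

theorem IsCtx.mul_left {c : Word Z → Word Z} (hc : IsCtx c) (a : Word Z) :
    IsCtx fun x => a * c x := by
  simpa using hc.mul a 1

theorem IsCtx.mul_right {c : Word Z → Word Z} (hc : IsCtx c) (b : Word Z) :
    IsCtx fun x => c x * b := by
  simpa using hc.mul 1 b

theorem IsCtx.comp {c p : Word Z → Word Z} (hc : IsCtx c) (hp : IsCtx p) :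
    IsCtx fun x => c (p x) := by
  induction hc with
  | base a b => exact hp.mul a b
  | br a b _ ih => exact IsCtx.br a b ih

theorem lift_const_of_starCount_eq_zero (q : Word (Option Z)) (h : starCount q = 0) :
    ∃ w : Word Z, ∀ a : Word Z,
      Word.lift Word.br (fun o : Option Z => o.elim a Word.var) q = w := by
  induction q with
  | nil => exact ⟨1, fun _ => rfl⟩
  | cons x t ih =>
    cases x with
    | none => exact absurd h (Nat.succ_ne_zero _)
    | some z =>
      obtain ⟨w, hw⟩ := ih h
      exact ⟨Word.var z * w, fun a => by rw [← hw a]; rfl⟩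
  | consBr u t ihu iht =>
    obtain ⟨h1, h2⟩ := Nat.add_eq_zero_iff.mp h
    obtain ⟨w, hw⟩ := ihu h1
    obtain ⟨w', hw'⟩ := iht h2
    exact ⟨Word.br w * w', fun a => by rw [← hw a, ← hw' a]; rfl⟩

/-- At each letter the unique `⋆` is on one side only; the other side evaluates to a constant word.
-/
theorem isCtx_lift_of_starCount_eq_one (q : Word (Option Z)) (h : starCount q = 1) :
    IsCtx fun a : Word Z => Word.lift Word.br (fun o : Option Z => o.elim a Word.var) q := by
  induction q with
  | nil => exact absurd h (by simp [starCount])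
  | cons x t ih =>
    cases x with
    | none =>
      obtain ⟨w, hw⟩ := lift_const_of_starCount_eq_zero t (Nat.succ.inj h)
      convert IsCtx.base (1 : Word Z) w using 2 with a
      rw [← hw a, one_mul]; rfl
    | some z => exact (ih h).mul_left (Word.var z)
  | consBr u t ihu iht =>
    have h' : starCount u + starCount t = 1 := h
    rcases Nat.eq_zero_or_pos (starCount u) with h0 | h0
    · obtain ⟨w, hw⟩ := lift_const_of_starCount_eq_zero u h0
      convert (iht (by omega)).mul_left (Word.br w) using 2 with a
      rw [← hw a]; rfl
    · obtain ⟨w, hw⟩ := lift_const_of_starCount_eq_zero t (by omega)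
      convert IsCtx.br 1 w (ihu (by omega)) using 2 with a
      rw [← hw a, one_mul]; rfl

theorem StarWord.isCtx_plug (q : StarWord Z) : IsCtx q.plug :=
  isCtx_lift_of_starCount_eq_one q.1 q.2

theorem starCount_mul (a b : Word (Option Z)) :
    starCount (a * b) = starCount a + starCount b := by
  induction a with
  | nil => exact (Nat.zero_add _).symm
  | cons x t ih =>
    rw [Word.cons_mul]
    cases x with
    | none => simp only [starCount, ih]; omega
    | some z => simp only [starCount, ih]
  | consBr a t _ ih => rw [Word.consBr_mul]; simp only [starCount, ih]; omega

/-- A word on `Z` as a word on `Z ∪ {⋆}`. -/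
def Word.toOption : Word Z →* Word (Option Z) :=
  Word.lift Word.br fun z => Word.var (some z)

theorem starCount_toOption (a : Word Z) : starCount a.toOption = 0 := by
  induction a with
  | nil => rfl
  | cons x t ih => exact ih
  | consBr a t iha iht =>
    change starCount a.toOption + starCount t.toOption = 0
    rw [iha, iht]

theorem lift_toOption (a x : Word Z) :
    Word.lift Word.br (fun o : Option Z => o.elim x Word.var) a.toOption = a := by
  induction a with
  | nil => rfl
  | cons z t ih =>
    change Word.var z * Word.lift Word.br (fun o : Option Z => o.elim x Word.var) t.toOption = _
    rw [ih]; rfl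
  | consBr a t iha iht =>
    change Word.br (Word.lift Word.br (fun o : Option Z => o.elim x Word.var) a.toOption) *
      Word.lift Word.br (fun o : Option Z => o.elim x Word.var) t.toOption = _
    rw [iha, iht]; rfl

/-- With `StarWord.isCtx_plug` this identifies contexts with `⋆`-bracketed words, so arguments can
use composition and induction on functions instead of counting stars. -/
theorem IsCtx.exists_starWord {c : Word Z → Word Z} (hc : IsCtx c) :
    ∃ q : StarWord Z, q.plug = c := by
  induction hc with
  | base a b =>
    refine ⟨⟨a.toOption * (Word.var none * b.toOption), ?_⟩, ?_⟩
    · rw [starCount_mul, starCount_mul, starCount_toOption, starCount_toOption]; rfl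
    · funext x
      simp only [StarWord.plug, map_mul, lift_toOption, Word.lift_var]
      rfl
  | br a b _ ih =>
    obtain ⟨q, rfl⟩ := ih
    refine ⟨⟨a.toOption * (Word.br q.1 * b.toOption), ?_⟩, ?_⟩
    · rw [starCount_mul, starCount_mul, starCount_toOption, starCount_toOption]
      change 0 + (starCount q.1 + 0 + 0) = 1
      rw [q.2]
    · funext x
      simp only [StarWord.plug, map_mul, lift_toOption, Word.lift_br]

/-- The relative positions of the occurrences of `u₁` in `c₁ u₁` and of `u₂` in `c₂ u₂`, up to
exchanging the two. -/
inductive Placement (u₁ u₂ : Word Z) (c₁ c₂ : Word Z → Word Z) : Prop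
  | nested (p : Word Z → Word Z) (hp : IsCtx p) (hu : u₁ = p u₂) (h : ∀ x, c₂ x = c₁ (p x))
  | overlap (c : Word Z → Word Z) (a b : Word Z) (hc : IsCtx c) (hw : u₁ * a = b * u₂)
      (hmax : max u₁.breadth u₂.breadth < (u₁ * a).breadth)
      (hlt : (u₁ * a).breadth < u₁.breadth + u₂.breadth)
      (h₁ : ∀ x, c₁ x = c (x * a)) (h₂ : ∀ x, c₂ x = c (b * x))
  | separated (D : Word Z → Word Z → Word Z) (hD₁ : ∀ y, IsCtx fun x => D x y)
      (hD₂ : ∀ x, IsCtx (D x)) (h₁ : ∀ x, c₁ x = D x u₂) (h₂ : ∀ y, c₂ y = D u₁ y)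

theorem Placement.comp {u₁ u₂ : Word Z} {c₁ c₂ c : Word Z → Word Z} (hc : IsCtx c)
    (h : Placement u₁ u₂ c₁ c₂) :
    Placement u₁ u₂ (fun x => c (c₁ x)) (fun x => c (c₂ x)) := by
  cases h with
  | nested p hp hu h => exact .nested p hp hu fun x => by rw [h]
  | overlap c' a b hc' hw hmax hlt h₁ h₂ =>
    exact .overlap (fun x => c (c' x)) a b (hc.comp hc') hw hmax hlt
      (fun x => by rw [h₁]) (fun x => by rw [h₂])
  | separated D hD₁ hD₂ h₁ h₂ =>
    exact .separated (fun x y => c (D x y)) (fun y => hc.comp (hD₁ y))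
      (fun x => hc.comp (hD₂ x)) (fun x => by rw [h₁]) (fun y => by rw [h₂])

theorem Placement.separated_base {u₁ u₂ : Word Z} {c₂ : Word Z → Word Z} (hc₂ : IsCtx c₂)
    (a b : Word Z) {c : Word Z → Word Z} (hc : IsCtx c) :
    Placement u₁ u₂ (fun x => a * (c x * (b * c₂ u₂))) (fun y => a * (c u₁ * (b * c₂ y))) :=
  .separated (fun x y => a * (c x * (b * c₂ y))) (fun y => hc.mul a (b * c₂ y))
    (fun x => ((hc₂.mul_left b).mul_left (c x)).mul_left a) (fun _ => rfl) (fun _ => rfl)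

/-- Both subwords lie in the same outermost product, with `u₁` starting no later than `u₂`. Levi's
lemma tells whether `u₁` ends before `u₂` starts, and if not, which of them ends first. -/
theorem Placement.base_base_aux {u₁ u₂ e b b' : Word Z} (a : Word Z)
    (h : u₁ * b = e * (u₂ * b')) :
    Placement u₁ u₂ (fun x => a * (x * b)) (fun x => a * e * (x * b')) ∨
      Placement u₂ u₁ (fun x => a * e * (x * b')) (fun x => a * (x * b)) := by
  rcases Word.levi h with ⟨e', rfl, rfl⟩ | ⟨e', rfl, h2⟩
  · left
    simpa only [mul_assoc] using
      Placement.separated_base (u₁ := u₁) (u₂ := u₂) (IsCtx.id.mul_right b') a e' IsCtx.id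
  · rcases Word.levi h2 with ⟨f, rfl, rfl⟩ | ⟨f, rfl, rfl⟩
    · exact .inl (.nested (fun x => e * (x * f)) (.base e f) rfl
        fun x => by simp only [mul_assoc])
    -- Here `u₁ = e * e'` and `u₂ = e' * f`. If `e` or `f` is empty, one word contains the other; if
    -- `e'` is empty, they are adjacent. Otherwise all three are nonempty, which gives the strict
    -- breadth bounds of a genuine overlap.
    · by_cases he : e = 1
      · subst he
        exact .inr (.nested (fun x => 1 * (x * f)) (.base 1 f) (by simp)
          fun x => by simp only [mul_assoc, one_mul])
      by_cases hf : f = 1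
      · subst hf
        exact .inl (.nested (fun x => e * (x * 1)) (.base e 1) (by simp)
          fun x => by simp only [mul_assoc, mul_one, one_mul])
      by_cases he' : e' = 1
      · subst he'
        left
        simpa only [mul_assoc, one_mul, mul_one] using
          Placement.separated_base (u₁ := e) (u₂ := f)
            (IsCtx.id.mul_right b') a 1 IsCtx.id
      have h1 := mt Word.breadth_eq_zero.mp he
      have h2 := mt Word.breadth_eq_zero.mp hf
      have h3 := mt Word.breadth_eq_zero.mp he'
      exact .inl (.overlap (fun x => a * (x * b')) f e (.base a b') (mul_assoc _ _ _)
        (by simp only [Word.breadth_mul]; omega) (by simp only [Word.breadth_mul]; omega)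
        (fun x => by simp only [mul_assoc]) (fun x => by simp only [mul_assoc]))

/-- The bracket holding `u₂` is one letter of the product in which `u₁` is a factor, so it lies
before, inside or after `u₁`; partial overlap is impossible. -/
theorem Placement.base_br {u₁ u₂ a b a' b' : Word Z} {c : Word Z → Word Z} (hc : IsCtx c)
    (h : a * (u₁ * b) = a' * (Word.br (c u₂) * b')) :
    Placement u₁ u₂ (fun x => a * (x * b)) (fun x => a' * (Word.br (c x) * b')) ∨
      Placement u₂ u₁ (fun x => a' * (Word.br (c x) * b')) (fun x => a * (x * b)) := by
  have hbr : IsCtx fun x => Word.br (c x) := by simpa using IsCtx.br 1 1 hc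
  rcases Word.levi_br h with ⟨e, rfl, rfl⟩ | ⟨e, rfl, h2⟩
  · right
    simpa only [mul_assoc] using
      Placement.separated_base (u₁ := u₂) (u₂ := u₁) (IsCtx.id.mul_right b) a' e hbr
  · rcases Word.levi_br h2 with ⟨f, rfl, rfl⟩ | ⟨f, rfl, rfl⟩
    · exact .inl (.nested (fun x => e * (Word.br (c x) * f)) (.br e f hc) rfl
        fun x => by simp only [mul_assoc])
    · left
      simpa only [mul_assoc] using
        Placement.separated_base (u₁ := u₁) (u₂ := u₂) (hbr.mul_right b') a f IsCtx.id

/-- Two occurrences of subwords in a bracketed word are nested, overlapping or separated. -/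
theorem placement {u₁ u₂ : Word Z} {c₁ c₂ : Word Z → Word Z} (hc₁ : IsCtx c₁) (hc₂ : IsCtx c₂)
    (h : c₁ u₁ = c₂ u₂) : Placement u₁ u₂ c₁ c₂ ∨ Placement u₂ u₁ c₂ c₁ := by
  induction hc₁ generalizing c₂ with
  | base a b =>
    cases hc₂ with
    | base a' b' =>
      rcases Word.levi h with ⟨e, rfl, h2⟩ | ⟨e, rfl, h2⟩
      · exact Placement.base_base_aux a h2
      · exact (Placement.base_base_aux a' h2).symm
    | br a' b' hc => exact Placement.base_br hc h
  | @br a b c hc ih =>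
    cases hc₂ with
    | base a' b' => exact (Placement.base_br hc h.symm).symm
    | @br a' b' c' hc' =>
      have hbr : IsCtx fun x => Word.br (c x) := by simpa using IsCtx.br 1 1 hc
      have hbr' : IsCtx fun x => Word.br (c' x) := by simpa using IsCtx.br 1 1 hc'
      rcases Word.levi_br h with ⟨e, rfl, rfl⟩ | ⟨e, rfl, h2⟩
      · right
        simpa only [mul_assoc] using
          Placement.separated_base (u₁ := u₂) (u₂ := u₁) (hbr.mul_right b) a' e hbr'
      · cases e with
        -- Both holes lie in the same outermost bracket: recurse inside it.
        | nil =>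
          obtain ⟨h3, rfl⟩ := Word.consBr.inj h2
          rw [Word.nil_eq_one, mul_one]
          have hctx : IsCtx fun x => a * (Word.br x * b) := .br a b .id
          exact (ih hc' h3).imp
            (Placement.comp (c := fun x => a * (Word.br x * b)) hctx)
            (Placement.comp (c := fun x => a * (Word.br x * b)) hctx)
        | cons y s => exact nomatch h2
        | consBr y s =>
          obtain ⟨rfl, h4⟩ := Word.consBr.inj h2
          have h5 : b = s * (Word.br (c' u₂) * b') := h4
          subst h5
          left
          simpa only [mul_assoc, Word.consBr_eq] using
            Placement.separated_base (u₁ := u₁) (u₂ := u₂) (hbr'.mul_right b') a s hbr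

end Contexts

/-! ### Leading monomials and their behaviour under contexts. -/

section LeadingMonomials

variable {k : Type u} [Field k] {Z : Type w} {ord : LinearOrder (Word Z)}

theorem le_lm {f : Poly k Z} {a : Word Z} (ha : a ∈ f.coeff.support) :
    ord.le a (lm ord f) := by
  rw [lm, dif_pos ⟨a, ha⟩]
  exact @Finset.le_max' _ ord _ _ ha

theorem lm_eq {f : Poly k Z} {a : Word Z} (ha : a ∈ f.coeff.support)
    (h : ∀ b ∈ f.coeff.support, ord.le b a) : lm ord f = a :=
  ord.le_antisymm _ _
    (h _ (lm_mem ord f fun h0 => by simp [h0] at ha)) (le_lm ha)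

theorem coeff_lm_ne_zero {f : Poly k Z} (hf : f ≠ 0) : f.coeff (lm ord f) ≠ 0 :=
  Finsupp.mem_support_iff.mp (lm_mem ord f hf)

theorem support_monic {f : Poly k Z} (hf : f ≠ 0) :
    (monic ord f).coeff.support = f.coeff.support :=
  Finsupp.support_smul_eq (inv_ne_zero (coeff_lm_ne_zero hf))

theorem lm_monic {f : Poly k Z} (hf : f ≠ 0) : lm ord (monic ord f) = lm ord f :=
  lm_eq (by rw [support_monic hf]; exact lm_mem ord f hf)
    fun b hb => le_lm (by rwa [support_monic hf] at hb)

theorem coeff_monic_lm {f : Poly k Z} (hf : f ≠ 0) : (monic ord f).coeff (lm ord f) = 1 :=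
  inv_mul_cancel₀ (coeff_lm_ne_zero hf)

/-- The linear extension to `𝐤𝔐(Z)` of a function `𝔐(Z) → 𝔐(Z)`. -/
noncomputable abbrev mapWord (c : Word Z → Word Z) : Poly k Z →ₗ[k] Poly k Z :=
  MonoidAlgebra.mapDomainLinearMap k k c

theorem mapWord_mono (c : Word Z → Word Z) (a : Word Z) :
    mapWord c (mono k a) = mono k (c a) :=
  MonoidAlgebra.mapDomainLinearMap_single ..

theorem mapWord_mapWord (c p : Word Z → Word Z) (f : Poly k Z) :
    mapWord c (mapWord p f) = mapWord (fun x => c (p x)) f :=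
  (LinearMap.congr_fun (MonoidAlgebra.mapDomainLinearMap_comp p c) f).symm

theorem eq_sum_mono (f : Poly k Z) :
    f = ∑ x ∈ f.coeff.support, f.coeff x • mono k x := by
  conv_lhs => rw [← MonoidAlgebra.sum_coeff_single f]
  exact Finset.sum_congr rfl fun x _ => by simp [mono]

theorem mapWord_eq_sum (c : Word Z → Word Z) (f : Poly k Z) :
    mapWord c f = ∑ x ∈ f.coeff.support, f.coeff x • mono k (c x) := by
  conv_lhs => rw [eq_sum_mono f, map_sum]
  exact Finset.sum_congr rfl fun x _ => by rw [map_smul, mapWord_mono]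

theorem exists_of_mem_support_mapWord {c : Word Z → Word Z} {f : Poly k Z} {a : Word Z}
    (ha : a ∈ (mapWord c f).coeff.support) : ∃ x ∈ f.coeff.support, c x = a := by
  classical
  exact Finset.mem_image.mp (Finsupp.mapDomain_support ha)

theorem mapWord_mul_right (a : Word Z) (f : Poly k Z) :
    mapWord (fun x => x * a) f = f * mono k a := by
  conv_rhs => rw [eq_sum_mono f, Finset.sum_mul]
  rw [mapWord_eq_sum]
  exact Finset.sum_congr rfl fun x _ => by simp [mono, MonoidAlgebra.single_mul_single]

theorem mapWord_mul_left (b : Word Z) (f : Poly k Z) :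
    mapWord (fun x => b * x) f = mono k b * f := by
  conv_rhs => rw [eq_sum_mono f, Finset.mul_sum]
  rw [mapWord_eq_sum]
  exact Finset.sum_congr rfl fun x _ => by simp [mono, MonoidAlgebra.single_mul_single]

theorem IsMonomialOrder.ctx_lt (hord : IsMonomialOrder ord) {c : Word Z → Word Z}
    (hc : IsCtx c) {a b : Word Z} (h : ord.lt a b) : ord.lt (c a) (c b) := by
  obtain ⟨q, rfl⟩ := hc.exists_starWord
  exact hord.plug_lt a b q h

theorem IsMonomialOrder.ctx_le (hord : IsMonomialOrder ord) {c : Word Z → Word Z}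
    (hc : IsCtx c) {a b : Word Z} (h : ord.le a b) : ord.le (c a) (c b) := by
  rcases @lt_or_eq_of_le _ ord.toPartialOrder _ _ h with h | rfl
  · exact @le_of_lt _ ord.toPreorder _ _ (hord.ctx_lt hc h)
  · exact ord.le_refl _

/-- Contexts are strictly increasing for a total order. Hence plugging never merges monomials, and
coefficients are carried over unchanged. -/
theorem IsMonomialOrder.ctx_injective (hord : IsMonomialOrder ord) {c : Word Z → Word Z}
    (hc : IsCtx c) : Function.Injective c := by
  intro a b h
  rcases @lt_trichotomy _ ord a b with hl | hl | hl
  · exact absurd h (@ne_of_lt _ ord.toPreorder _ _ (hord.ctx_lt hc hl))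
  · exact hl
  · exact absurd h.symm (@ne_of_lt _ ord.toPreorder _ _ (hord.ctx_lt hc hl))

theorem IsMonomialOrder.coeff_mapWord (hord : IsMonomialOrder ord) {c : Word Z → Word Z}
    (hc : IsCtx c) (f : Poly k Z) (a : Word Z) : (mapWord c f).coeff (c a) = f.coeff a :=
  Finsupp.mapDomain_apply (hord.ctx_injective hc) _ _

theorem IsMonomialOrder.le_of_mem_support_mapWord (hord : IsMonomialOrder ord)
    {c : Word Z → Word Z} (hc : IsCtx c) {f : Poly k Z} {a : Word Z}
    (ha : a ∈ (mapWord c f).coeff.support) : ord.le a (c (lm ord f)) := by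
  obtain ⟨x, hx, rfl⟩ := exists_of_mem_support_mapWord ha
  exact hord.ctx_le hc (le_lm hx)

end LeadingMonomials

/-! ### Triviality of compositions and the composition-diamond lemma. -/

section Spans

variable {k : Type u} [Field k] {Z : Type w} {ord : LinearOrder (Word Z)} {S : Set (Poly k Z)}

/-- The span of the `q|_s` with `s ∈ S` whose leading monomial satisfies `P`. -/
noncomputable def leadingSpan (ord : LinearOrder (Word Z)) (S : Set (Poly k Z)) (P : Word Z → Prop) :
    Submodule k (Poly k Z) :=
  Submodule.span k {p | ∃ s ∈ S, ∃ q : StarWord Z, P (q.plug (lm ord s)) ∧ p = q.plugPoly s}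

theorem trivialMod_iff {w : Word Z} {h : Poly k Z} :
    TrivialMod ord S w h ↔ h ∈ leadingSpan ord S (ord.lt · w) := Iff.rfl

theorem leadingSpan_mono {P Q : Word Z → Prop} (h : ∀ a, P a → Q a) :
    leadingSpan ord S P ≤ leadingSpan ord S Q :=
  Submodule.span_mono fun _ ⟨s, hs, q, hq, hp⟩ => ⟨s, hs, q, h _ hq, hp⟩

theorem mapWord_mem_leadingSpan {P : Word Z → Prop} {s : Poly k Z} (hs : s ∈ S)
    {c : Word Z → Word Z} (hc : IsCtx c) (h : P (c (lm ord s))) :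
    mapWord c s ∈ leadingSpan ord S P := by
  obtain ⟨q, rfl⟩ := hc.exists_starWord
  exact Submodule.subset_span ⟨s, hs, q, h, rfl⟩

theorem mapWord_monic_mem_leadingSpan {P : Word Z → Prop} {s : Poly k Z} (hs : s ∈ S)
    {c : Word Z → Word Z} (hc : IsCtx c) (h : P (c (lm ord s))) :
    mapWord c (monic ord s) ∈ leadingSpan ord S P := by
  rw [monic, map_smul]
  exact Submodule.smul_mem _ _ (mapWord_mem_leadingSpan hs hc h)

/-- Contexts compose and preserve strict inequalities. This transports a trivial composition into a
larger word. -/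
theorem TrivialMod.mapWord (hord : IsMonomialOrder ord) {w : Word Z} {h : Poly k Z}
    (ht : TrivialMod ord S w h) {c : Word Z → Word Z} (hc : IsCtx c) :
    TrivialMod ord S (c w) (mapWord c h) := by
  refine Submodule.span_induction (p := fun h _ => TrivialMod ord S (c w) (RotaOPI.mapWord c h))
    ?_ ?_ ?_ ?_ ht
  · rintro _ ⟨s, hs, q, hq, rfl⟩
    change TrivialMod ord S (c w) (RotaOPI.mapWord c (RotaOPI.mapWord q.plug s))
    rw [mapWord_mapWord]
    exact trivialMod_iff.mpr (mapWord_mem_leadingSpan (P := (ord.lt · (c w))) hs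
      (hc.comp q.isCtx_plug) (hord.ctx_lt hc hq))
  · rw [map_zero]; exact Submodule.zero_mem _
  · intro x y _ _ hx hy
    rw [map_add]; exact Submodule.add_mem _ hx hy
  · intro r x _ hx
    rw [map_smul]; exact Submodule.smul_mem _ _ hx

theorem TrivialMod.lt_of_mem_support (hord : IsMonomialOrder ord) {w : Word Z} {h : Poly k Z}
    (ht : TrivialMod ord S w h) {a : Word Z} (ha : a ∈ h.coeff.support) : ord.lt a w := by
  classical
  refine Submodule.span_induction (p := fun h _ => ∀ a ∈ h.coeff.support, ord.lt a w)
    ?_ ?_ ?_ ?_ ht a ha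
  · rintro _ ⟨s, hs, q, hq, rfl⟩ a ha
    exact @lt_of_le_of_lt _ ord.toPreorder _ _ _
      (hord.le_of_mem_support_mapWord q.isCtx_plug ha) hq
  · intro a ha; simp at ha
  · intro x y _ _ hx hy a ha
    rcases Finset.mem_union.mp (Finsupp.support_add ha) with h | h
    · exact hx a h
    · exact hy a h
  · intro r x _ hx a ha
    exact hx a (Finsupp.support_smul ha)

/-- Compositions of two elements at separated occurrences are trivial. -/
theorem trivialMod_separated (hord : IsMonomialOrder ord) {f g : Poly k Z} (hfS : f ∈ S)
    (hgS : g ∈ S) (hf : f ≠ 0) (hg : g ≠ 0) {D : Word Z → Word Z → Word Z}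
    (hD₁ : ∀ y, IsCtx fun x => D x y) (hD₂ : ∀ x, IsCtx (D x)) :
    TrivialMod ord S (D (lm ord f) (lm ord g))
      (mapWord (fun x => D x (lm ord g)) (monic ord f) -
        mapWord (D (lm ord f)) (monic ord g)) := by
  classical
  set w := D (lm ord f) (lm ord g) with hw
  set F := monic ord f with hF
  set G := monic ord g with hG
  -- The bilinear expression `D(F, G)` is expanded in each argument. Removing the leading term from
  -- each side leaves the wanted difference as a combination of terms with a smaller monomial in one
  -- slot.
  have key : ∑ y ∈ G.coeff.support, G.coeff y • mapWord (fun x => D x y) F =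
      ∑ x ∈ F.coeff.support, F.coeff x • mapWord (D x) G := by
    simp only [mapWord_eq_sum, Finset.smul_sum]
    rw [Finset.sum_comm]
    exact Finset.sum_congr rfl fun x _ => Finset.sum_congr rfl fun y _ => smul_comm _ _ _
  have hF1 : lm ord f ∈ F.coeff.support := by
    rw [hF, support_monic hf]; exact lm_mem ord f hf
  have hG1 : lm ord g ∈ G.coeff.support := by
    rw [hG, support_monic hg]; exact lm_mem ord g hg
  rw [← Finset.add_sum_erase _ _ hG1, ← Finset.add_sum_erase _ _ hF1, hF, hG,
    coeff_monic_lm hf, coeff_monic_lm hg, one_smul, one_smul, ← hF, ← hG] at key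
  have key' : mapWord (fun x => D x (lm ord g)) F - mapWord (D (lm ord f)) G =
      ∑ x ∈ F.coeff.support.erase (lm ord f), F.coeff x • mapWord (D x) G -
      ∑ y ∈ G.coeff.support.erase (lm ord g), G.coeff y • mapWord (fun x => D x y) F := by
    rw [sub_eq_sub_iff_add_eq_add, key, add_comm]
  rw [key', trivialMod_iff]
  refine Submodule.sub_mem _ (Submodule.sum_mem _ fun x hx => Submodule.smul_mem _ _ ?_)
    (Submodule.sum_mem _ fun y hy => Submodule.smul_mem _ _ ?_)
  · obtain ⟨hne, hx⟩ := Finset.mem_erase.mp hx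
    rw [hF, support_monic hf] at hx
    exact mapWord_monic_mem_leadingSpan hgS (hD₂ x)
      (hord.ctx_lt (hD₁ (lm ord g)) (@lt_of_le_of_ne _ ord.toPartialOrder _ _ (le_lm hx) hne))
  · obtain ⟨hne, hy⟩ := Finset.mem_erase.mp hy
    rw [hG, support_monic hg] at hy
    exact mapWord_monic_mem_leadingSpan hfS (hD₁ y)
      (hord.ctx_lt (hD₂ (lm ord f)) (@lt_of_le_of_ne _ ord.toPartialOrder _ _ (le_lm hy) hne))

/-- Nested and overlapping placements are including and intersection compositions inside a context;
separated ones are trivial without any hypothesis on compositions. -/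
theorem IsGSBasis.trivialMod_of_placement (hord : IsMonomialOrder ord) (hS : IsGSBasis ord S)
    {f g : Poly k Z} (hfS : f ∈ S) (hgS : g ∈ S) (hf : f ≠ 0) (hg : g ≠ 0)
    {c₁ c₂ : Word Z → Word Z} (hc₁ : IsCtx c₁)
    (hp : Placement (lm ord f) (lm ord g) c₁ c₂) :
    TrivialMod ord S (c₁ (lm ord f))
      (mapWord c₁ (monic ord f) - mapWord c₂ (monic ord g)) := by
  obtain ⟨hint, hinc⟩ := hS f hfS g hgS hf hg
  cases hp with
  | nested p hp hu h =>
    obtain rfl : c₂ = fun x => c₁ (p x) := funext h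
    obtain ⟨q, rfl⟩ := hp.exists_starWord
    rw [← mapWord_mapWord c₁ q.plug, ← map_sub]
    refine TrivialMod.mapWord hord ?_ hc₁
    exact hinc (lm ord f) q (lm_monic hf).symm (by rw [lm_monic hg]; exact hu)
  | overlap c a b hc hw hmax hlt h₁ h₂ =>
    obtain rfl : c₁ = fun x => c (x * a) := funext h₁
    obtain rfl : c₂ = fun x => c (b * x) := funext h₂
    rw [← mapWord_mapWord c (fun x => x * a), ← mapWord_mapWord c (fun x => b * x), ← map_sub,
      mapWord_mul_right, mapWord_mul_left]
    refine TrivialMod.mapWord hord ?_ hc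
    refine hint _ a b ?_ ?_ ?_ ?_ <;>
      simp only [lm_monic hf, lm_monic hg] <;> assumption
  | separated D hD₁ hD₂ h₁ h₂ =>
    obtain rfl : c₁ = fun x => D x (lm ord g) := funext h₁
    obtain rfl : c₂ = D (lm ord f) := funext h₂
    exact trivialMod_separated hord hfS hgS hf hg hD₁ hD₂

/-- In a Gröbner–Shirshov basis, any two `q|_s` with the same leading monomial are congruent. -/
theorem IsGSBasis.trivialMod_sub (hord : IsMonomialOrder ord) (hS : IsGSBasis ord S)
    {f g : Poly k Z} (hfS : f ∈ S) (hgS : g ∈ S) (hf : f ≠ 0) (hg : g ≠ 0)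
    {c₁ c₂ : Word Z → Word Z} (hc₁ : IsCtx c₁) (hc₂ : IsCtx c₂)
    (h : c₁ (lm ord f) = c₂ (lm ord g)) :
    TrivialMod ord S (c₁ (lm ord f))
      (mapWord c₁ (monic ord f) - mapWord c₂ (monic ord g)) := by
  rcases placement hc₁ hc₂ h with hp | hp
  · exact hS.trivialMod_of_placement hord hfS hgS hf hg hc₁ hp
  · rw [h, ← neg_sub]
    exact Submodule.neg_mem _ (hS.trivialMod_of_placement hord hgS hfS hg hf hc₂ hp)

/-- A finite combination attains its largest leading monomial, so the strict bound `w` can be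
lowered to a smaller non-strict one. The zero case is needed because nothing may lie below `w`. -/
theorem TrivialMod.eq_zero_or_exists_lt {w : Word Z} {h : Poly k Z}
    (ht : TrivialMod ord S w h) :
    h = 0 ∨ ∃ w', ord.lt w' w ∧ h ∈ leadingSpan ord S (ord.le · w') := by
  refine Submodule.span_induction
    (p := fun h _ => h = 0 ∨ ∃ w', ord.lt w' w ∧ h ∈ leadingSpan ord S (ord.le · w'))
    ?_ ?_ ?_ ?_ ht
  · rintro _ ⟨s, hs, q, hq, rfl⟩
    exact .inr ⟨_, hq, Submodule.subset_span ⟨s, hs, q, ord.le_refl _, rfl⟩⟩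
  · exact .inl rfl
  · rintro x y _ _ (rfl | ⟨a, ha, hx⟩) (rfl | ⟨b, hb, hy⟩)
    · exact .inl (add_zero 0)
    · exact .inr ⟨b, hb, by rwa [zero_add]⟩
    · exact .inr ⟨a, ha, by rwa [add_zero]⟩
    · rcases ord.le_total a b with h | h
      · exact .inr ⟨b, hb, Submodule.add_mem _
          (leadingSpan_mono (fun c hc => ord.le_trans c a b hc h) hx) hy⟩
      · exact .inr ⟨a, ha, Submodule.add_mem _ hx
          (leadingSpan_mono (fun c hc => ord.le_trans c b a hc h) hy)⟩
  · rintro r x _ (rfl | ⟨a, ha, hx⟩)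
    · exact .inl (smul_zero r)
    · exact .inr ⟨a, ha, Submodule.smul_mem _ _ hx⟩

theorem exists_mem_leadingSpan_le {h : Poly k Z} (hh : h ∈ leadingSpan ord S fun _ => True) :
    ∃ w, h ∈ leadingSpan ord S (ord.le · w) := by
  refine Submodule.span_induction (p := fun h _ => ∃ w, h ∈ leadingSpan ord S (ord.le · w))
    ?_ ?_ ?_ ?_ hh
  · rintro _ ⟨s, hs, q, hq, rfl⟩
    exact ⟨_, Submodule.subset_span ⟨s, hs, q, ord.le_refl _, rfl⟩⟩
  · exact ⟨1, Submodule.zero_mem _⟩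
  · rintro x y _ _ ⟨a, hx⟩ ⟨b, hy⟩
    rcases ord.le_total a b with h | h
    · exact ⟨b, Submodule.add_mem _
        (leadingSpan_mono (fun c hc => ord.le_trans c a b hc h) hx) hy⟩
    · exact ⟨a, Submodule.add_mem _ hx
        (leadingSpan_mono (fun c hc => ord.le_trans c b a hc h) hy)⟩
  · rintro r x _ ⟨a, hx⟩
    exact ⟨a, Submodule.smul_mem _ _ hx⟩

/-- All generators with leading monomial exactly `c (lm ord s)` are congruent to multiples of the
one built from `s`, so together they collapse to a single multiple. -/
theorem IsGSBasis.exists_trivialMod_sub_smul (hord : IsMonomialOrder ord) (hS : IsGSBasis ord S)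
    {s : Poly k Z} (hs : s ∈ S) (hs0 : s ≠ 0) {c : Word Z → Word Z} (hc : IsCtx c)
    {h : Poly k Z} (hh : h ∈ leadingSpan ord S (ord.le · (c (lm ord s)))) :
    ∃ r : k, TrivialMod ord S (c (lm ord s)) (h - r • mapWord c (monic ord s)) := by
  refine Submodule.span_induction
    (p := fun h _ => ∃ r : k, TrivialMod ord S (c (lm ord s)) (h - r • mapWord c (monic ord s)))
    ?_ ?_ ?_ ?_ hh
  · rintro _ ⟨t, ht, q, hq, rfl⟩
    -- The convention `lm 0 = 1` gives `0` a meaningless leading monomial, but its plugged copies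
    -- vanish.
    by_cases ht0 : t = 0
    · subst ht0
      exact ⟨0, by rw [map_zero, zero_smul, sub_zero]; exact Submodule.zero_mem _⟩
    rcases @lt_or_eq_of_le _ ord.toPartialOrder _ _ hq with hq | hq
    · exact ⟨0, by rw [zero_smul, sub_zero]; exact Submodule.subset_span ⟨t, ht, q, hq, rfl⟩⟩
    · refine ⟨t.coeff (lm ord t), ?_⟩
      have e : q.plugPoly t = t.coeff (lm ord t) • mapWord q.plug (monic ord t) := by
        rw [monic, map_smul, smul_smul, mul_inv_cancel₀ (coeff_lm_ne_zero ht0), one_smul]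
        rfl
      rw [e, ← smul_sub, ← hq]
      exact Submodule.smul_mem _ _ (hS.trivialMod_sub hord ht hs ht0 hs0 q.isCtx_plug hc hq)
  · exact ⟨0, by rw [zero_smul, sub_zero]; exact Submodule.zero_mem _⟩
  · rintro x y _ _ ⟨a, hx⟩ ⟨b, hy⟩
    refine ⟨a + b, ?_⟩
    rw [add_smul, add_sub_add_comm]
    exact Submodule.add_mem _ hx hy
  · rintro r x _ ⟨a, hx⟩
    refine ⟨r * a, ?_⟩
    rw [mul_smul, ← smul_sub]
    exact Submodule.smul_mem _ _ hx

/-- The composition-diamond lemma: the leading monomial of a nonzero element of the ideal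
generated by a Gröbner–Shirshov basis `S` is `q|_{lm s}` for some `s ∈ S`. -/
theorem IsGSBasis.exists_lm_eq (hord : IsMonomialOrder ord) (hS : IsGSBasis ord S)
    {h : Poly k Z} (hh : h ∈ leadingSpan ord S fun _ => True) (h0 : h ≠ 0) :
    ∃ s ∈ S, s ≠ 0 ∧ ∃ q : StarWord Z, lm ord h = q.plug (lm ord s) := by
  obtain ⟨w, hw⟩ := exists_mem_leadingSpan_le hh
  clear hh
  -- Induction on the bound `w` of a representation of `h`, which may exceed `lm h` when top terms
  -- cancel.
  induction w using hord.wf.induction generalizing h with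
  | _ w ih =>
    have below : TrivialMod ord S w h →
        ∃ s ∈ S, s ≠ 0 ∧ ∃ q : StarWord Z, lm ord h = q.plug (lm ord s) := by
      intro ht
      rcases ht.eq_zero_or_exists_lt with h1 | ⟨w', hlt, h1⟩
      · exact absurd h1 h0
      · exact ih w' hlt h0 h1
    by_cases hex : ∃ s ∈ S, s ≠ 0 ∧ ∃ q : StarWord Z, w = q.plug (lm ord s)
    · obtain ⟨s, hs, hs0, q, rfl⟩ := hex
      obtain ⟨r, hr⟩ := hS.exists_trivialMod_sub_smul hord hs hs0 q.isCtx_plug hw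
      -- If `r = 0`, the top terms cancel and the bound drops; otherwise `w` survives with
      -- coefficient `r` and is the leading monomial.
      by_cases hr0 : r = 0
      · rw [hr0, zero_smul, sub_zero] at hr
        exact below hr
      refine ⟨s, hs, hs0, q, lm_eq ?_ ?_⟩
      · have h1 : (h - r • mapWord q.plug (monic ord s)).coeff (q.plug (lm ord s)) = 0 := by
          by_contra hne
          exact @lt_irrefl _ ord.toPreorder _
            (hr.lt_of_mem_support hord (Finsupp.mem_support_iff.mpr hne))
        rw [MonoidAlgebra.coeff_sub, MonoidAlgebra.coeff_smul, Finsupp.sub_apply,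
          Finsupp.smul_apply, hord.coeff_mapWord q.isCtx_plug, coeff_monic_lm hs0, smul_eq_mul,
          mul_one, sub_eq_zero] at h1
        rw [Finsupp.mem_support_iff, h1]
        exact hr0
      · intro b hb
        classical
        have e : h = (h - r • mapWord q.plug (monic ord s)) +
          r • mapWord q.plug (monic ord s) := (sub_add_cancel _ _).symm
        rw [e] at hb
        rcases Finset.mem_union.mp (Finsupp.support_add hb) with hb | hb
        · exact @le_of_lt _ ord.toPreorder _ _ (hr.lt_of_mem_support hord hb)
        · have := hord.le_of_mem_support_mapWord q.isCtx_plug (Finsupp.support_smul hb)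
          rwa [lm_monic hs0] at this
    · refine below (Submodule.span_le.mpr ?_ hw)
      rintro _ ⟨s, hs, q, hq, rfl⟩
      by_cases hs0 : s = 0
      · subst hs0
        rw [map_zero]
        exact Submodule.zero_mem _
      rcases @lt_or_eq_of_le _ ord.toPartialOrder _ _ hq with hq | hq
      · exact Submodule.subset_span ⟨s, hs, q, hq, rfl⟩
      · exact absurd ⟨s, hs, hs0, q, hq.symm⟩ hex

end Spans

/-! ### Termination, and confluence versus triviality of compositions. -/

section Rewriting

variable {k : Type u} [Field k] {Z : Type w} {ord : LinearOrder (Word Z)} {S : Set (Poly k Z)}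

theorem plugPoly_remainder (q : StarWord Z) (s : Poly k Z) :
    q.plugPoly (remainder (lm ord s) s) =
      mono k (q.plug (lm ord s)) - mapWord q.plug (monic ord s) := by
  rw [remainder, map_sub]
  exact congrArg (· - _) (mapWord_mono q.plug _)

theorem lt_of_mem_rules (hord : IsMonomialOrder ord) {t : Word Z} {v : Poly k Z}
    (h : (t, v) ∈ rules S (lmOrient ord S)) {a : Word Z} (ha : a ∈ v.coeff.support) :
    ord.lt a t := by
  obtain ⟨s, hs, hs0, q, hp⟩ := h
  obtain ⟨rfl, rfl⟩ := Prod.mk.inj hp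
  change a ∈ (q.plugPoly (remainder (lm ord s) s)).coeff.support at ha
  change ord.lt a (q.plug (lm ord s))
  obtain ⟨x, hx, rfl⟩ := exists_of_mem_support_mapWord ha
  refine hord.plug_lt _ _ q (@lt_of_le_of_ne _ ord.toPartialOrder _ _ ?_ ?_)
  · by_contra hle
    refine Finsupp.mem_support_iff.mp hx ?_
    have h1 : x ∉ s.coeff.support := fun h => hle (le_lm h)
    have h2 : lm ord s ≠ x := fun h => hle (h ▸ ord.le_refl _)
    simp [remainder, mono, Finsupp.notMem_support_iff.mp h1, h2]
  · rintro rfl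
    refine Finsupp.mem_support_iff.mp hx ?_
    simp [remainder, mono, inv_mul_cancel₀ (coeff_lm_ne_zero (ord := ord) hs0)]

/-- Coefficient functions are compared lexicographically, largest monomial first. A step at `t`
makes the coefficient of `t` zero and leaves those of larger monomials alone. -/
theorem terminating_rules_lmOrient (hord : IsMonomialOrder ord) :
    Terminating (rules S (lmOrient ord S)) := by
  rintro ⟨f, hf⟩
  let r : Word Z → Word Z → Prop := fun a b => ord.lt b a
  -- On coefficients the only descent is from nonzero to zero, which is well-founded over any field.
  let z : k → k → Prop := fun a b => a = 0 ∧ b ≠ 0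
  have hz : WellFounded z := by
    have h0 : ∀ a, a = 0 → Acc z a := fun a ha => ⟨a, fun b hb => absurd ha hb.2⟩
    exact ⟨fun a => ⟨a, fun b hb => h0 b hb.1⟩⟩
  have : Std.Trichotomous r := ⟨fun a b h1 h2 =>
    @le_antisymm _ ord.toPartialOrder _ _ (@le_of_not_gt _ ord _ _ h1)
      (@le_of_not_gt _ ord _ _ h2)⟩
  have wf : WellFounded (Finsupp.Lex r z) :=
    Finsupp.Lex.wellFounded' (fun _ h => h.2 rfl) hz hord.wf
  refine (wellFounded_iff_isEmpty_descending_chain.mp wf).false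
    ⟨fun n => (f n).coeff, fun n => ?_⟩
  obtain ⟨t, v, hr, ht, hg⟩ := hf n
  have hv : ∀ a, ¬ ord.lt a t → v.coeff a = 0 := fun a ha => by
    by_contra h
    exact ha (lt_of_mem_rules hord hr (Finsupp.mem_support_iff.mpr h))
  refine ⟨t, fun d hd => ?_, ?_, Finsupp.mem_support_iff.mp ht⟩
  · have hne : t ≠ d := fun h => @lt_irrefl _ ord.toPreorder _ (h ▸ hd : ord.lt t t)
    simp [hg, hv d (@lt_asymm _ ord.toPreorder _ _ hd), hne]
  · simp [hg, hv t (@lt_irrefl _ ord.toPreorder _)]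

/-- One-step rewriting at `q|_{lm s}` subtracts a multiple of `q|_s`. -/
theorem OneStep.exists_sub_eq {f g : Poly k Z} (h : OneStep (rules S (lmOrient ord S)) f g) :
    ∃ s ∈ S, s ≠ 0 ∧ ∃ q : StarWord Z, q.plug (lm ord s) ∈ f.coeff.support ∧
      f - g = f.coeff (q.plug (lm ord s)) • mapWord q.plug (monic ord s) := by
  obtain ⟨t, v, ⟨s, hs, hs0, q, hp⟩, ht, rfl⟩ := h
  obtain ⟨rfl, rfl⟩ := Prod.mk.inj hp
  refine ⟨s, hs, hs0, q, ht, ?_⟩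
  change f - (f.coeff (q.plug (lm ord s)) • q.plugPoly (remainder (lm ord s) s) -
    (MonoidAlgebra.single (q.plug (lm ord s)) (f.coeff (q.plug (lm ord s))) - f)) = _
  rw [plugPoly_remainder, smul_sub]
  have e : f.coeff (q.plug (lm ord s)) • mono k (q.plug (lm ord s)) =
    MonoidAlgebra.single (q.plug (lm ord s)) (f.coeff (q.plug (lm ord s))) := by simp [mono]
  rw [e]
  abel

theorem exists_oneStep {f : Poly k Z} {s : Poly k Z} (hs : s ∈ S) (hs0 : s ≠ 0)
    (q : StarWord Z) (hq : q.plug (lm ord s) ∈ f.coeff.support) :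
    ∃ g, OneStep (rules S (lmOrient ord S)) f g :=
  ⟨_, _, _, ⟨s, hs, hs0, q, rfl⟩, hq, rfl⟩

theorem Rewrites.sub_mem {f g : Poly k Z} (h : Rewrites (rules S (lmOrient ord S)) f g) :
    f - g ∈ leadingSpan ord S fun _ => True := by
  induction h with
  | refl => rw [sub_self]; exact Submodule.zero_mem _
  | @tail b c _ hbc ih =>
    obtain ⟨s, hs, _, q, _, e⟩ := hbc.exists_sub_eq
    rw [← sub_add_sub_cancel f b c, e]
    exact Submodule.add_mem _ ih (Submodule.smul_mem _ _
      (mapWord_monic_mem_leadingSpan hs q.isCtx_plug trivial))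

/-- Rewriting an element all of whose monomials are smaller than `w` is trivial modulo `w`. -/
theorem Rewrites.trivialMod_sub (hord : IsMonomialOrder ord) {w : Word Z} {f g : Poly k Z}
    (h : Rewrites (rules S (lmOrient ord S)) f g) (hf : ∀ a ∈ f.coeff.support, ord.lt a w) :
    TrivialMod ord S w (f - g) := by
  classical
  -- The support bound must travel along the chain: it places the monomial rewritten at the next
  -- step below `w`.
  suffices TrivialMod ord S w (f - g) ∧ ∀ a ∈ g.coeff.support, ord.lt a w from this.1
  induction h with
  | refl => exact ⟨by rw [sub_self]; exact Submodule.zero_mem _, hf⟩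
  | @tail b c _ hbc ih =>
    obtain ⟨ih1, ih2⟩ := ih
    obtain ⟨s, hs, _, q, hq, e⟩ := hbc.exists_sub_eq
    have h1 : TrivialMod ord S w (b - c) := by
      rw [e]
      exact trivialMod_iff.mpr (Submodule.smul_mem _ _
        (mapWord_monic_mem_leadingSpan (P := (ord.lt · w)) hs q.isCtx_plug (ih2 _ hq)))
    refine ⟨?_, fun a ha => ?_⟩
    · rw [trivialMod_iff] at ih1 h1 ⊢
      rw [← sub_add_sub_cancel f b c]
      exact Submodule.add_mem _ ih1 h1
    · rw [← sub_sub_cancel b c] at ha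
      rcases Finset.mem_union.mp (Finsupp.support_sub ha) with h | h
      · exact ih2 a h
      · exact h1.lt_of_mem_support hord h

theorem Terminating.exists_normal_form {W : Type w} {R : Set (W × MonoidAlgebra k W)}
    (h : Terminating R) (f : MonoidAlgebra k W) :
    ∃ g, Rewrites R f g ∧ ∀ g', ¬ OneStep R g g' := by
  have wf : WellFounded fun g f => OneStep R f g :=
    wellFounded_iff_isEmpty_descending_chain.mpr ⟨fun c => h ⟨c.1, c.2⟩⟩
  induction f using wf.induction with
  | _ f ih =>
    by_cases hf : ∃ g, OneStep R f g
    · obtain ⟨g, hg⟩ := hf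
      obtain ⟨g', h1, h2⟩ := ih g hg
      exact ⟨g', Relation.ReflTransGen.head hg h1, h2⟩
    · exact ⟨f, Relation.ReflTransGen.refl, fun g' hg' => hf ⟨g', hg'⟩⟩

/-- If two normal forms of `f` differed, the leading monomial of their difference would be reducible
and would occur in one of them, which could then be rewritten. -/
theorem IsGSBasis.confluent (hord : IsMonomialOrder ord) (hS : IsGSBasis ord S) :
    Confluent (rules S (lmOrient ord S)) := by
  classical
  intro f g h hg hh
  obtain ⟨g', hg1, hg2⟩ := (terminating_rules_lmOrient (S := S) hord).exists_normal_form g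
  obtain ⟨h', hh1, hh2⟩ := (terminating_rules_lmOrient (S := S) hord).exists_normal_form h
  suffices e : g' = h' from ⟨g', hg1, e ▸ hh1⟩
  by_contra hne
  have hmem : g' - h' ∈ leadingSpan ord S fun _ => True := by
    rw [← sub_sub_sub_cancel_left h' g' f]
    exact Submodule.sub_mem _ (Rewrites.sub_mem (hh.trans hh1)) (Rewrites.sub_mem (hg.trans hg1))
  obtain ⟨s, hs, hs0, q, e⟩ := hS.exists_lm_eq hord hmem (sub_ne_zero.mpr hne)
  have hlm := lm_mem ord _ (sub_ne_zero.mpr hne)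
  rw [e] at hlm
  rcases Finset.mem_union.mp (Finsupp.support_sub hlm) with h | h
  · obtain ⟨x, hx⟩ := exists_oneStep hs hs0 q h
    exact hg2 x hx
  · obtain ⟨x, hx⟩ := exists_oneStep hs hs0 q h
    exact hh2 x hx

theorem rewrites_mono (w : Word Z) {s : Poly k Z} (hs : s ∈ S) (hs0 : s ≠ 0) (q : StarWord Z)
    (hw : w = q.plug (lm ord s)) :
    Rewrites (rules S (lmOrient ord S)) (mono k w)
      (mono k w - mapWord q.plug (monic ord s)) := by
  subst hw
  refine Relation.ReflTransGen.single ⟨_, _, ⟨s, hs, hs0, q, rfl⟩, ?_, ?_⟩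
  · change q.plug (lm ord s) ∈ _
    simp [mono]
  · change _ = (mono k (q.plug (lm ord s))).coeff (q.plug (lm ord s)) •
      q.plugPoly (remainder (lm ord s) s) - (MonoidAlgebra.single (q.plug (lm ord s))
        ((mono k (q.plug (lm ord s))).coeff (q.plug (lm ord s))) - mono k (q.plug (lm ord s)))
    rw [plugPoly_remainder]
    simp [mono]

theorem lt_of_mem_support_mono_sub (hord : IsMonomialOrder ord) {s : Poly k Z} (hs : s ∈ S)
    (hs0 : s ≠ 0) (q : StarWord Z) {a : Word Z}
    (ha : a ∈ (mono k (q.plug (lm ord s)) - mapWord q.plug (monic ord s)).coeff.support) :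
    ord.lt a (q.plug (lm ord s)) := by
  rw [← plugPoly_remainder] at ha
  exact lt_of_mem_rules (S := S) hord ⟨s, hs, hs0, q, rfl⟩ ha

/-- In a confluent system, any two `q|_s` with the same leading monomial are congruent. -/
theorem Confluent.trivialMod_sub (hord : IsMonomialOrder ord)
    (hS : Confluent (rules S (lmOrient ord S))) {f g : Poly k Z} (hfS : f ∈ S) (hgS : g ∈ S)
    (hf : f ≠ 0) (hg : g ≠ 0) {w : Word Z} (q₁ q₂ : StarWord Z) (h₁ : w = q₁.plug (lm ord f))
    (h₂ : w = q₂.plug (lm ord g)) :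
    TrivialMod ord S w (mapWord q₁.plug (monic ord f) - mapWord q₂.plug (monic ord g)) := by
  -- The monomial `w` rewrites to `w - q₁|_f` and to `w - q₂|_g`, with `f`, `g` made monic. Both
  -- have support below `w`, hence are congruent to their common reduct `h` modulo terms below `w`.
  obtain ⟨h, hfh, hgh⟩ := hS _ _ _ (rewrites_mono w hfS hf q₁ h₁) (rewrites_mono w hgS hg q₂ h₂)
  have t₁ := hfh.trivialMod_sub hord (w := w) fun a ha => by
    rw [h₁] at ha ⊢
    exact lt_of_mem_support_mono_sub hord hfS hf q₁ ha
  have t₂ := hgh.trivialMod_sub hord (w := w) fun a ha => by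
    rw [h₂] at ha ⊢
    exact lt_of_mem_support_mono_sub hord hgS hg q₂ ha
  have := Submodule.sub_mem _ t₂ t₁
  rwa [sub_sub_sub_cancel_right, sub_sub_sub_cancel_left] at this

/-- An intersection composition compares the contexts `x * a` and `b * x`; an including one compares
the identity context and `q`. -/
theorem Confluent.isGSBasis (hord : IsMonomialOrder ord)
    (hS : Confluent (rules S (lmOrient ord S))) : IsGSBasis ord S := by
  intro f hfS g hgS hf hg
  constructor
  · intro w a b h₁ h₂ _ _
    rw [lm_monic hf] at h₁
    rw [lm_monic hg] at h₂
    obtain ⟨q₁, hq₁⟩ := (IsCtx.id.mul_right a).exists_starWord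
    obtain ⟨q₂, hq₂⟩ := (IsCtx.id.mul_left b).exists_starWord
    have := Confluent.trivialMod_sub hord hS hfS hgS hf hg (w := w) q₁ q₂
      (by rw [hq₁, h₁]) (by rw [hq₂, h₂])
    rwa [hq₁, hq₂, mapWord_mul_right, mapWord_mul_left] at this
  · intro w q h₁ h₂
    rw [lm_monic hf] at h₁
    rw [lm_monic hg] at h₂
    obtain ⟨q₁, hq₁⟩ := (IsCtx.id (Z := Z)).exists_starWord
    have := Confluent.trivialMod_sub hord hS hfS hgS hf hg q₁ q (by rw [hq₁, h₁]) h₂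
    rw [hq₁] at this
    have e : mapWord (fun x => x) (monic ord f) = monic ord f := by
      rw [mapWord_eq_sum, ← eq_sum_mono]
    rwa [e] at this

/-- A set is a Gröbner–Shirshov basis if and only if its rewriting system for the orientation by
leading monomials is convergent. -/
theorem isGSBasis_iff_convergent (hord : IsMonomialOrder ord) :
    IsGSBasis ord S ↔ Convergent (rules S (lmOrient ord S)) :=
  ⟨fun h => ⟨terminating_rules_lmOrient hord, h.confluent hord⟩,
    fun h => Confluent.isGSBasis hord h.2⟩

end Rewriting

end RotaOPI

/-! ### The theorem for systems of OPIs. -/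

theorem mainTheorem2 {k : Type u} [Field k] {X : Type v} (Φ : Set (RotaOPI.Poly k X)) :
    (∀ (Z : Type w) (ord : LinearOrder (RotaOPI.Word Z)), RotaOPI.IsMonomialOrder ord →
      (RotaOPI.GSOn Φ Z ord ↔
        RotaOPI.ConvergentOn Φ Z (RotaOPI.lmOrient ord (RotaOPI.substSet Φ Z)))) ∧
    (RotaOPI.IsGS.{u, v, w} Φ → RotaOPI.IsConvergent.{u, v, w} Φ) ∧
    (RotaOPI.IsPotentiallyGS.{u, v, w} Φ → RotaOPI.IsPotentiallyConvergent.{u, v, w} Φ) := by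
  refine ⟨fun Z ord hord => RotaOPI.isGSBasis_iff_convergent hord, fun h Z => ?_, fun h Z => ?_⟩
  · obtain ⟨ord, hord, hgs⟩ := h Z
    exact ⟨RotaOPI.lmOrient ord _, (RotaOPI.isGSBasis_iff_convergent hord).mp hgs⟩
  · obtain ⟨ord, hord, Φ', hsub, hid, hgs⟩ := h Z
    -- The leading monomial of `s` does not depend on the set containing `s`, so the orientation for
    -- `Φ'` extends the one for `Φ` by definition.
    exact ⟨RotaOPI.lmOrient ord _, Φ', hsub, hid, RotaOPI.lmOrient ord _, fun _ _ _ => rfl,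
      (RotaOPI.isGSBasis_iff_convergent hord).mp hgs⟩
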